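/- Let $p$ be a prime, let $K/\mathbb{Q}_p$ be a finite extension with algebraic closure $\overline{K}$, and let $|\cdot|$ be the absolute value on $K$ extending the $p$-adic absolute value. Let $f(z)=\sum_{i=0}^d a_iz^i\in K[z]$ be a monic polynomial of degree $d$ with $p\nmid d$, and suppose that $f$ has good reduction, i.e. $|a_i|\le 1$ for all $i$. Let $P\in K$ be a point outside the filled Julia set of $f$, i.e. such that the forward orbit $\{f^N(P): N\ge 0\}$ is an unbounded subset of $K$ (here $f^N$ is the $N$-th iterate of $f$). Let $T$ be the rooted tree of iterated preimages of $P$: the nodes at level $N\geq 0$ are the $x\in\overline{K}$ with $f^N(x)=P$, and the node below a node $x$ at level $N+1$ is the node $f(x)$ at level $N$. Let $\operatorname{Aut}(T)$ be the group of automorphisms of this rooted tree, and let $\rho_{f,P}:\operatorname{Gal}(\overline{K}/K)\to\operatorname{Aut}(T)$ be the arboreal Galois representation, given by the action of the Galois group on the nodes. A *consistent labelling* of $T$ is a labelling, for each $N\geq 0$, of the nodes at level $N$ as $\alpha_k$ with $k\in\mathbb{Z}/d^N\mathbb{Z}$ (each node receiving exactly one label and each label being used exactly once), such that for $N\geq 1$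 the node below $\alpha_k$ is labelled by the image of $k$ under the natural map $\mathbb{Z}/d^N\mathbb{Z}\to\mathbb{Z}/d^{N-1}\mathbb{Z}$. A *Kummer subgroup* of $\operatorname{Aut}(T)$ is a subgroup $G$ for which there is a consistent labelling of $T$ such that, for every $N$, the restriction of $G$ to the nodes at level $N$ is isomorphic to $(\mathbb{Z}/d^N\mathbb{Z})\rtimes(\mathbb{Z}/d^N\mathbb{Z})^\times$, acting by $(i,j)\alpha_k=\alpha_{jk+i}$. Then there is a Kummer subgroup $G$ of $\operatorname{Aut}(T)$ such that the image of $\rho_{f,P}$ is contained in $G$ and has finite index in $G$. -/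

import Mathlib

/-- A rooted tree, given by its levels: `node N` is the set of nodes at distance `N` from the root,
there is exactly one node at level `0`, and every node at level `N + 1` is joined to
exactly one node `parent N x` at level `N`. -/
structure LevelledTree where
  node : ℕ → Type*
  root : Unique (node 0)
  parent : ∀ N, node (N + 1) → node N

namespace LevelledTree

/-- The group `Aut(T)` of automorphisms of a rooted tree: families of permutations of the levels
that are compatible with the edges of the tree. -/
def Aut (T : LevelledTree) : Subgroup (∀ N, Equiv.Perm (T.node N)) where
  carrier := {g | ∀ N (x : T.node (N + 1)), T.parent N (g (N + 1) x) = g N (T.parent N x)}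
  mul_mem' := by
    intro g h hg hh N x
    simp only [Set.mem_ofPred_eq] at hg hh
    simp [hg, hh]
  one_mem' := by
    intro N x
    simp
  inv_mem' := by
    intro g hg N x
    have h := hg N ((g (N + 1)).symm x)
    rw [Equiv.apply_symm_apply] at h
    change T.parent N ((g (N + 1)).symm x) = (g N).symm (T.parent N x)
    rw [h, Equiv.symm_apply_apply]

/-- The restriction of tree automorphisms to the nodes at level `N`. -/
def restrict (T : LevelledTree) (N : ℕ) : T.Aut →* Equiv.Perm (T.node N) :=
  (Pi.evalMonoidHom (fun N => Equiv.Perm (T.node N)) N).comp T.Aut.subtype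

/-- A consistent labelling of `T`: for every `N`, the nodes at level `N` are labelled bijectively
as `α N k` with `k ∈ ℤ/d^N`, and the node below `α (N + 1) k` is the one that is labelled by the
image of `k` under the natural map `ℤ/d^(N+1) → ℤ/d^N`. -/
structure ConsistentLabelling (T : LevelledTree) (d : ℕ) where
  α : ∀ N, ZMod (d ^ N) ≃ T.node N
  parent_α : ∀ N (k : ZMod (d ^ (N + 1))),
    T.parent N (α (N + 1) k) =
      α N (ZMod.castHom (pow_dvd_pow d (Nat.le_succ N)) (ZMod (d ^ N)) k)

end LevelledTree

/-- The action of `(ℤ/n)ˣ` on the additive group `ℤ/n` by multiplication. -/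
def unitsAction (n : ℕ) : (ZMod n)ˣ →* MulAut (Multiplicative (ZMod n)) :=
  (MulAutMultiplicative (ZMod n)).symm.toMonoidHom.comp
    (DistribMulAction.toAddAut (ZMod n)ˣ (ZMod n))

/-- The semidirect product `(ℤ/n) ⋊ (ℤ/n)ˣ`. -/
abbrev AffineZMod (n : ℕ) : Type := Multiplicative (ZMod n) ⋊[unitsAction n] (ZMod n)ˣ

/-- A Kummer subgroup of `Aut(T)`: for some consistent labelling of `T`, the restriction of `G` to
the nodes at each level `N` is isomorphic to `(ℤ/d^N) ⋊ (ℤ/d^N)ˣ`, acting by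
`(i, j) α_k = α_{j k + i}`. -/
def LevelledTree.IsKummerSubgroup (T : LevelledTree) (d : ℕ) (G : Subgroup T.Aut) : Prop :=
  ∃ L : T.ConsistentLabelling d, ∀ N : ℕ,
    ∃ e : AffineZMod (d ^ N) ≃* G.map (T.restrict N),
      ∀ (a : AffineZMod (d ^ N)) (k : ZMod (d ^ N)),
        (e a : Equiv.Perm (T.node N)) (L.α N k) =
          L.α N ((a.right : ZMod (d ^ N)) * k + Multiplicative.toAdd a.left)

section Preimages

variable {K : Type*} [Field K]

/-- The tree `T` of iterated preimages of `P` under `f`: the nodes at level `N` are the `x` in the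
algebraic closure of `K` such that `f^N(x) = P`, and `x` at level `N + 1` is joined to `f(x)`. -/
noncomputable def preimageTree (f : Polynomial K) (P : K) : LevelledTree where
  node N := {x : AlgebraicClosure K //
    (fun z => Polynomial.aeval z f)^[N] x = algebraMap K (AlgebraicClosure K) P}
  root :=
    { default := ⟨algebraMap K (AlgebraicClosure K) P, Function.iterate_zero_apply _ _⟩
      uniq := fun x => Subtype.ext ((Function.iterate_zero_apply _ _).symm.trans x.2) }
  parent _ x := ⟨Polynomial.aeval x.1 f, (Function.iterate_succ_apply _ _ _).symm.trans x.2⟩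

/-- Elements of the Galois group commute with the iterates of `f`. -/
theorem galois_iterate (f : Polynomial K) (σ : Gal(AlgebraicClosure K/K)) (N : ℕ)
    (x : AlgebraicClosure K) :
    (fun z => Polynomial.aeval z f)^[N] (σ x) = σ ((fun z => Polynomial.aeval z f)^[N] x) := by
  induction N generalizing x with
  | zero => simp only [Function.iterate_zero_apply]
  | succ N ih =>
    simp only [Function.iterate_succ, Function.comp_apply]
    rw [← ih]
    exact congrArg _ (Polynomial.aeval_algHom_apply σ x f)

/-- The permutation of the nodes at level `N` induced by an element of the Galois group. -/
noncomputable def galoisPerm (f : Polynomial K) (P : K) (N : ℕ)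
    (σ : Gal(AlgebraicClosure K/K)) : Equiv.Perm ((preimageTree f P).node N) :=
  σ.toEquiv.subtypeEquiv fun x => by
    change _ ↔ (fun z => Polynomial.aeval z f)^[N] (σ x) = _
    rw [galois_iterate]
    constructor
    · intro h
      rw [h]
      exact σ.commutes P
    · intro h
      exact σ.injective (h.trans (σ.commutes P).symm)

/-- The arboreal Galois representation `ρ_{f, P} : Gal(K̄/K) → Aut(T)`. -/
noncomputable def arborealRep (f : Polynomial K) (P : K) :
    Gal(AlgebraicClosure K/K) →* (preimageTree f P).Aut where
  toFun σ := ⟨fun N => galoisPerm f P N σ, fun _ x =>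
    Subtype.ext (Polynomial.aeval_algHom_apply σ x.1 f)⟩
  map_one' := Subtype.ext (funext fun _ => Equiv.ext fun _ => Subtype.ext rfl)
  map_mul' _ _ := Subtype.ext (funext fun _ => Equiv.ext fun _ => Subtype.ext rfl)

end Preimages

/-- The filled Julia set of `f`: the elements of `K` whose forward orbit under `f` is bounded. -/
def filledJulia {K : Type*} [NormedField K] (f : Polynomial K) : Set K :=
  {z | Bornology.IsBounded (Set.range fun n : ℕ => (fun w => f.eval w)^[n] z)}

/-- Good reduction of a monic polynomial: all coefficients have absolute value at most `1`. -/
def HasGoodReduction {K : Type*} [NormedField K] (f : Polynomial K) : Prop :=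
  ∀ i : ℕ, ‖f.coeff i‖ ≤ 1

/-!
Outside the filled Julia set `|P| > 1`, so every node `x` at level `N` satisfies `|x| > 1`, and
`f(x)` has the same leading term as `x ^ d`. Hence `f^N(x) = P` forces `x` to share its leading
term with a `d ^ N`-th root of `P`. As `|d| = 1`, distinct roots have distinct leading terms, and
counting makes this a Galois-equivariant bijection between roots and nodes. Labelling the node close
to `ζ ^ k * P ^ (1 / d ^ N)` by `k` makes Galois act by affine maps of `ℤ/d^N`.

The index of the image among all affine maps is bounded uniformly in `N`. If the image contains `c`
translations and a Frobenius element with linear part `q`, then `P ^ (c * (q - 1))` is a `d ^ N`-th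
power in `K`; discreteness of the value group makes `c` at least a fixed fraction of `d ^ N`. By
lifting the exponent, so is the order of `q` modulo `d ^ N`. The image is closed in `Aut(T)`, so
bounded index at all levels gives finite index.
-/

open Polynomial IntermediateField

namespace AffineZMod

variable {n : ℕ}

/-- The affine action of `(ℤ/n) ⋊ (ℤ/n)ˣ` on `ℤ/n`, in which `(i, j)` sends `k` to `j k + i`. -/
instance : MulAction (AffineZMod n) (ZMod n) where
  smul a k := a.right * k + a.left.toAdd
  one_smul k := by
    change ((1 : (ZMod n)ˣ) : ZMod n) * k + (1 : Multiplicative (ZMod n)).toAdd = k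
    simp
  mul_smul a b k := by
    change (a.right * b.right : ZMod n) * k + (a.left.toAdd + a.right * b.left.toAdd) =
      a.right * (b.right * k + b.left.toAdd) + a.left.toAdd
    ring

theorem smul_def (a : AffineZMod n) (k : ZMod n) : a • k = a.right * k + a.left.toAdd := rfl

theorem toAdd_left_mul (a b : AffineZMod n) :
    (a * b).left.toAdd = a.left.toAdd + a.right * b.left.toAdd := rfl

instance : FaithfulSMul (AffineZMod n) (ZMod n) where
  eq_of_smul_eq_smul {a b} h := by
    have hleft : a.left = b.left := by simpa [smul_def] using h 0
    have hright : (a.right : ZMod n) = b.right := by simpa [smul_def, hleft] using h 1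
    exact SemidirectProduct.ext hleft (Units.ext hright)

instance [NeZero n] : Finite (AffineZMod n) :=
  Finite.of_equiv _ SemidirectProduct.equivProd.symm

theorem card_le [NeZero n] : Nat.card (AffineZMod n) ≤ n * n := by
  rw [SemidirectProduct.card, Nat.card_congr Multiplicative.toAdd, Nat.card_zmod]
  gcongr
  simpa using Nat.card_le_card_of_injective ((↑) : (ZMod n)ˣ → ZMod n) Units.val_injective

/-- The affine map `k ↦ j k + i` of `ℤ/n` for natural numbers `i` and `j`: choosing `i` and `j`
once gives compatible affine maps for all moduli at the same time. -/
def ofNat (n i j : ℕ) (h : j.Coprime n) : AffineZMod n :=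
  ⟨.ofAdd i, ZMod.unitOfCoprime j h⟩

theorem ofNat_smul {i j : ℕ} (h : j.Coprime n) (k : ZMod n) : ofNat n i j h • k = j * k + i := rfl

theorem ofNat_val [NeZero n] (a : AffineZMod n) :
    ofNat n a.left.toAdd.val (a.right : ZMod n).val (ZMod.val_coe_unit_coprime a.right) = a := by
  refine SemidirectProduct.ext ?_ (Units.ext ?_) <;> simp [ofNat]

/-- The translation subgroup of a group of affine maps of `ℤ/n`. -/
def translations (Γ : Subgroup (AffineZMod n)) : AddSubgroup (ZMod n) :=
  Subgroup.toAddSubgroup' (Γ.comap SemidirectProduct.inl)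

theorem mem_translations {Γ : Subgroup (AffineZMod n)} {s : ZMod n} :
    s ∈ translations Γ ↔ SemidirectProduct.inl (.ofAdd s) ∈ Γ := Iff.rfl

theorem commutator_mem_translations {Γ : Subgroup (AffineZMod n)} {a b : AffineZMod n}
    (ha : a ∈ Γ) (hb : b ∈ Γ) :
    (a.right - 1 : ZMod n) * b.left.toAdd - (b.right - 1 : ZMod n) * a.left.toAdd ∈
      translations Γ := by
  have hab : a * b = SemidirectProduct.inl (.ofAdd
      ((a.right - 1 : ZMod n) * b.left.toAdd - (b.right - 1 : ZMod n) * a.left.toAdd)) *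
      (b * a) := by
    refine SemidirectProduct.ext (Multiplicative.toAdd.injective ?_) ?_
    · simp only [toAdd_left_mul, SemidirectProduct.left_inl, SemidirectProduct.right_inl,
        toAdd_ofAdd, Units.val_one]
      ring
    · rw [SemidirectProduct.mul_right, SemidirectProduct.mul_right, SemidirectProduct.mul_right,
        SemidirectProduct.right_inl, one_mul, mul_comm]
  rw [mem_translations, ← mul_inv_eq_iff_eq_mul.2 hab]
  exact Γ.mul_mem (Γ.mul_mem ha hb) (Γ.inv_mem (Γ.mul_mem hb ha))

theorem card_translations_mul_commutator {Γ : Subgroup (AffineZMod n)} {a b : AffineZMod n}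
    (ha : a ∈ Γ) (hb : b ∈ Γ) :
    (Nat.card (translations Γ) : ZMod n) *
      ((a.right - 1 : ZMod n) * b.left.toAdd - (b.right - 1 : ZMod n) * a.left.toAdd) = 0 := by
  rw [← nsmul_eq_mul]
  exact congrArg Subtype.val
    (card_nsmul_eq_zero' (x := (⟨_, commutator_mem_translations ha hb⟩ : translations Γ)))

theorem card_translations_mul_orderOf_le [NeZero n] {Γ : Subgroup (AffineZMod n)}
    {a : AffineZMod n} (ha : a ∈ Γ) :
    Nat.card (translations Γ) * orderOf a.right ≤ Nat.card Γ := by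
  have h : Nat.card (translations Γ × Fin (orderOf a.right)) ≤ Nat.card Γ := by
    refine Nat.card_le_card_of_injective
      (fun x => (⟨SemidirectProduct.inl (.ofAdd x.1.1) * a ^ x.2.1,
        Γ.mul_mem (mem_translations.1 x.1.2) (Γ.pow_mem ha _)⟩ : Γ)) ?_
    rintro ⟨⟨s, hs⟩, k, hk⟩ ⟨⟨t, ht⟩, l, hl⟩ h
    have hst := congrArg Subtype.val h
    have hright := congrArg SemidirectProduct.rightHom hst
    simp only [map_mul, map_pow, SemidirectProduct.rightHom_inl, one_mul,
      SemidirectProduct.rightHom_eq_right] at hright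
    obtain rfl : k = l := pow_injOn_Iio_orderOf hk hl hright
    obtain rfl : s = t :=
      Multiplicative.ofAdd.injective (SemidirectProduct.inl_injective (mul_right_cancel hst))
    rfl
  simpa using h

theorem index_le [NeZero n] {Γ : Subgroup (AffineZMod n)} {a : AffineZMod n} (ha : a ∈ Γ)
    {c₁ c₂ : ℕ} (h₁ : c₁ ≠ 0) (h₂ : c₂ ≠ 0) (hc₁ : n ∣ c₁ * Nat.card (translations Γ))
    (hc₂ : n ∣ c₂ * orderOf a.right) : Γ.index ≤ c₁ * c₂ := by
  have hcard : 0 < Nat.card (translations Γ) := Nat.card_pos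
  have horder : 0 < orderOf a.right := orderOf_pos _
  refine Nat.le_of_mul_le_mul_right ?_ (Nat.card_pos (α := Γ))
  rw [Γ.index_mul_card]
  calc Nat.card (AffineZMod n) ≤ n * n := card_le
    _ ≤ (c₁ * Nat.card (translations Γ)) * (c₂ * orderOf a.right) :=
      Nat.mul_le_mul (Nat.le_of_dvd (by positivity) hc₁) (Nat.le_of_dvd (by positivity) hc₂)
    _ = c₁ * c₂ * (Nat.card (translations Γ) * orderOf a.right) := by ring
    _ ≤ c₁ * c₂ * Nat.card Γ := Nat.mul_le_mul_left _ (card_translations_mul_orderOf_le ha)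

end AffineZMod

namespace LevelledTree

variable {T : LevelledTree} {d : ℕ}

theorem restrict_apply (N : ℕ) (g : T.Aut) : T.restrict N g = g.1 N := rfl

theorem antitone_ker_restrict (hT : ∀ N, Function.Surjective (T.parent N)) :
    Antitone fun N => (T.restrict N).ker := by
  refine antitone_nat_of_succ_le fun N g hg => Equiv.ext fun x => ?_
  obtain ⟨y, rfl⟩ := hT N x
  have hg' : g.1 (N + 1) = 1 := hg
  rw [restrict_apply, ← g.2, hg', Equiv.Perm.one_apply, Equiv.Perm.one_apply]

namespace ConsistentLabelling

theorem parent_surjective (L : T.ConsistentLabelling d) (hd : d ≠ 0) (N : ℕ) :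
    Function.Surjective (T.parent N) := by
  have : NeZero (d ^ N) := ⟨pow_ne_zero _ hd⟩
  intro x
  obtain ⟨k, rfl⟩ := (L.α N).surjective x
  exact ⟨L.α (N + 1) k.val, by simp [L.parent_α]⟩

variable (L : T.ConsistentLabelling d)

/-- The action of the affine group of `ℤ/d^N` on the nodes at level `N` through their labels. -/
def affine (N : ℕ) : AffineZMod (d ^ N) →* Equiv.Perm (T.node N) :=
  (L.α N).permCongrHom.toMonoidHom.comp (MulAction.toPermHom _ _)

theorem affine_apply (N : ℕ) (a : AffineZMod (d ^ N)) (k : ZMod (d ^ N)) :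
    L.affine N a (L.α N k) = L.α N (a • k) := by
  simp [affine, Equiv.permCongrHom]

theorem affine_injective (N : ℕ) : Function.Injective (L.affine N) :=
  (L.α N).permCongrHom.injective.comp MulAction.toPerm_injective

theorem eq_affine_of_forall {N : ℕ} {g : Equiv.Perm (T.node N)} {a : AffineZMod (d ^ N)}
    (h : ∀ k, g (L.α N k) = L.α N (a • k)) : g = L.affine N a := by
  ext x
  obtain ⟨k, rfl⟩ := (L.α N).surjective x
  rw [h, affine_apply]

/-- The tree automorphism that acts as `k ↦ j k + i` on the labels of all levels. -/
def affineAut (i j : ℕ) (h : j.Coprime d) : T.Aut :=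
  ⟨fun N => L.affine N (.ofNat (d ^ N) i j (h.pow_right N)), fun N x => by
    obtain ⟨k, rfl⟩ := (L.α (N + 1)).surjective x
    simp only [affine_apply, L.parent_α, AffineZMod.ofNat_smul, map_add, map_mul, map_natCast]⟩

/-- The group of all tree automorphisms that act by affine maps on the labels of each level. -/
def affineGroup : Subgroup T.Aut :=
  ⨅ N, (L.affine N).range.comap (T.restrict N)

theorem mem_affineGroup {g : T.Aut} :
    g ∈ L.affineGroup ↔ ∀ N, ∃ a, L.affine N a = g.1 N := by
  simp [affineGroup, Subgroup.mem_iInf, restrict_apply]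

theorem affineAut_mem_affineGroup (i j : ℕ) (h : j.Coprime d) :
    L.affineAut i j h ∈ L.affineGroup :=
  L.mem_affineGroup.2 fun _ => ⟨_, rfl⟩

theorem exists_restrict_affineAut_eq (hd : d ≠ 0) (N : ℕ) (a : AffineZMod (d ^ N)) :
    ∃ i j, ∃ h : j.Coprime d, T.restrict N (L.affineAut i j h) = L.affine N a := by
  have : NeZero (d ^ N) := ⟨pow_ne_zero _ hd⟩
  rcases N.eq_zero_or_pos with rfl | hN
  · have := T.root
    exact ⟨0, 1, Nat.coprime_one_left d, Subsingleton.elim _ _⟩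
  · exact ⟨a.left.toAdd.val, (a.right : ZMod (d ^ N)).val,
      (Nat.coprime_pow_right_iff hN _ _).1 (ZMod.val_coe_unit_coprime a.right),
      congrArg (L.affine N) a.ofNat_val⟩

theorem map_restrict_affineGroup (hd : d ≠ 0) (N : ℕ) :
    L.affineGroup.map (T.restrict N) = (L.affine N).range := by
  apply le_antisymm
  · rintro _ ⟨g, hg, rfl⟩
    exact L.mem_affineGroup.1 hg N
  · rintro _ ⟨a, rfl⟩
    obtain ⟨i, j, h, hij⟩ := L.exists_restrict_affineAut_eq hd N a
    exact ⟨_, L.affineAut_mem_affineGroup i j h, hij⟩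

theorem isKummerSubgroup_affineGroup (hd : d ≠ 0) : T.IsKummerSubgroup d L.affineGroup :=
  ⟨L, fun N => ⟨((L.affine N).ofInjective (L.affine_injective N)).trans
    (MulEquiv.subgroupCongr (L.map_restrict_affineGroup hd N).symm), L.affine_apply N⟩⟩

end ConsistentLabelling

end LevelledTree

section FiniteIndex

variable {A : Type*} [Group A]

theorem finiteIndex_iInf_of_antitone {H : ℕ → Subgroup A} (hH : Antitone H) (C : ℕ)
    (h0 : ∀ N, (H N).index ≠ 0) (hC : ∀ N, (H N).index ≤ C) : (⨅ N, H N).FiniteIndex := by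
  obtain ⟨M, hM⟩ : ∃ M, ∀ N, (H N).index ≤ (H M).index := by
    refine ⟨Function.argmin fun N => C - (H N).index, fun N => ?_⟩
    have := Function.argmin_le (fun N => C - (H N).index) N
    have := hC N
    lia
  have hle : ∀ N, H M ≤ H N := by
    intro N
    rcases le_total N M with h | h
    · exact hH h
    · have : (H N).FiniteIndex := ⟨h0 N⟩
      by_contra hn
      exact (Subgroup.index_strictAnti (lt_of_le_not_ge (hH h) hn)).not_ge (hM N)
  rw [le_antisymm (iInf_le H M) (le_iInf hle)]
  exact ⟨h0 M⟩

theorem finiteIndex_subgroupOf_of_relIndex_map_le {B : ℕ → Type*} [∀ N, Group (B N)]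
    (ρ : ∀ N, A →* B N) (hρ : Antitone fun N => (ρ N).ker) {H G : Subgroup A}
    (hclosed : ∀ g, (∀ N, ρ N g ∈ H.map (ρ N)) → g ∈ H) (C : ℕ)
    (h0 : ∀ N, (H.map (ρ N)).relIndex (G.map (ρ N)) ≠ 0)
    (hC : ∀ N, (H.map (ρ N)).relIndex (G.map (ρ N)) ≤ C) :
    (H.subgroupOf G).FiniteIndex := by
  let S : ℕ → Subgroup G := fun N => ((H.map (ρ N)).comap (ρ N)).subgroupOf G
  have hindex : ∀ N, (S N).index = (H.map (ρ N)).relIndex (G.map (ρ N)) := fun N =>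
    Subgroup.relIndex_comap _ _ _
  have hanti : Antitone S := fun M N hMN => by
    refine Subgroup.comap_mono ?_
    simpa only [Subgroup.comap_map_eq] using sup_le_sup_left (hρ hMN) H
  have hfin := finiteIndex_iInf_of_antitone hanti C (fun N => hindex N ▸ h0 N)
    (fun N => hindex N ▸ hC N)
  refine Subgroup.finiteIndex_of_le (H := ⨅ N, S N) fun g hg => hclosed _ fun N => ?_
  exact Subgroup.mem_iInf.1 hg N

end FiniteIndex

section MultiplicativeOrder

theorem emultiplicity_pow_sub_one_of_sq_dvd {l : ℕ} (hl : l.Prime) {u : ℤ}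
    (hu : (l : ℤ) ^ 2 ∣ u - 1) (k : ℕ) :
    emultiplicity (l : ℤ) (u ^ k - 1) =
      emultiplicity (l : ℤ) (u - 1) + emultiplicity (l : ℤ) k := by
  have hlu : (l : ℤ) ∣ u - 1 := (dvd_pow_self _ two_ne_zero).trans hu
  have hnl : ¬ (l : ℤ) ∣ u := fun h =>
    (Nat.prime_iff_prime_int.1 hl).not_dvd_one (by simpa using dvd_sub h hlu)
  have hone : u ^ k - 1 = u ^ k - 1 ^ k := by rw [one_pow]
  rw [hone]
  rcases hl.eq_two_or_odd' with rfl | hodd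
  · exact Int.two_pow_sub_pow' k hu hnl
  · rw [Int.emultiplicity_pow_sub_pow hl hodd hlu hnl, Int.natCast_emultiplicity]

theorem pow_dvd_sub_one_mul_of_pow_dvd_pow_sub_one {d N k : ℕ} {u : ℤ}
    (hd : (d : ℤ) ^ 2 ∣ u - 1) (h : (d : ℤ) ^ N ∣ u ^ k - 1) : (d : ℤ) ^ N ∣ (u - 1) * k := by
  rw [← Nat.cast_pow, Int.natCast_dvd, Nat.dvd_iff_prime_pow_dvd_dvd]
  intro l m hl hm
  rcases Nat.eq_zero_or_pos m with rfl | hmpos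
  · simp
  have hld : l ∣ d := hl.dvd_of_dvd_pow ((dvd_pow_self l hmpos.ne').trans hm)
  have hlu : (l : ℤ) ^ 2 ∣ u - 1 := (pow_dvd_pow_of_dvd (Int.natCast_dvd_natCast.2 hld) 2).trans hd
  have hlm : (l : ℤ) ^ m ∣ u ^ k - 1 := by
    refine dvd_trans ?_ h
    exact_mod_cast hm
  rw [← Int.natCast_dvd, Nat.cast_pow, pow_dvd_iff_le_emultiplicity,
    emultiplicity_mul (Nat.prime_iff_prime_int.1 hl), ← emultiplicity_pow_sub_one_of_sq_dvd hl hlu,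
    ← pow_dvd_iff_le_emultiplicity]
  exact hlm

theorem exists_pow_dvd_mul_orderOf {d q : ℕ} (hq : 2 ≤ q) (hqd : q.Coprime d) :
    ∃ c ≠ 0, ∀ N (x : (ZMod (d ^ N))ˣ), (x : ZMod (d ^ N)) = q → d ^ N ∣ c * orderOf x := by
  rcases eq_or_ne d 0 with rfl | hd
  · obtain rfl := (Nat.coprime_zero_right q).1 hqd
    contradiction
  have hφ : 0 < (d ^ 2).totient := Nat.totient_pos.2 (by positivity)
  -- `u ≡ 1` modulo `d ^ 2`, so that lifting the exponent applies to `u` at every prime of `d`,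
  -- including `2`.
  set u := q ^ (d ^ 2).totient with hu
  have hu1 : 1 < u := Nat.one_lt_pow hφ.ne' hq
  have hu_cast : ((u - 1 : ℕ) : ℤ) = (u : ℤ) - 1 := by push_cast [hu1.le]; ring
  refine ⟨u - 1, by lia, fun N x hx => ?_⟩
  have hdu : (d : ℤ) ^ 2 ∣ u - 1 := by
    exact_mod_cast (Nat.modEq_iff_dvd.1 (Nat.ModEq.pow_totient (hqd.pow_right 2)).symm)
  have hdux : (d : ℤ) ^ N ∣ (u : ℤ) ^ orderOf x - 1 := by
    have hqx : (q : ZMod (d ^ N)) ^ orderOf x = 1 := by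
      rw [← hx, ← Units.val_pow_eq_pow_val, pow_orderOf_eq_one, Units.val_one]
    rw [← Nat.cast_pow, ← ZMod.intCast_zmod_eq_zero_iff_dvd]
    push_cast [hu]
    rw [pow_right_comm, hqx, one_pow, sub_self]
  have := pow_dvd_sub_one_mul_of_pow_dvd_pow_sub_one hdu hdux
  rw [← hu_cast] at this
  exact_mod_cast this

end MultiplicativeOrder

section Kummer

theorem pow_eq_pow_iff_natCast_eq {M : Type*} [CommMonoid M] {n : ℕ} [NeZero n] {ζ : M}
    (hζ : IsPrimitiveRoot ζ n) {k l : ℕ} : ζ ^ k = ζ ^ l ↔ (k : ZMod n) = l := by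
  rw [(isOfFinOrder_iff_pow_eq_one.2 ⟨n, NeZero.pos n, hζ.pow_eq_one⟩).pow_eq_pow_iff_modEq,
    ← hζ.eq_orderOf, ZMod.natCast_eq_natCast_iff]

theorem mem_range_algebraMap_of_pow_of_fixed {K Ω : Type*} [Field K] [Field Ω] [Algebra K Ω]
    [Normal K Ω] {n : ℕ} (hn : (n : K) ≠ 0) {x : Ω} {c : K} (hx : x ^ n = algebraMap K Ω c)
    (hfix : ∀ σ : Gal(Ω/K), σ x = x) : x ∈ Set.range (algebraMap K Ω) := by
  rcases eq_or_ne x 0 with rfl | hx0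
  · exact ⟨0, map_zero _⟩
  have hc : c ≠ 0 := by
    rintro rfl
    rw [map_zero] at hx
    exact pow_ne_zero n hx0 hx
  have hsep : IsSeparable K x := by
    refine (Polynomial.separable_X_pow_sub_C c hn hc).of_dvd (minpoly.dvd K x ?_)
    simp [hx]
  by_contra hmem
  obtain ⟨y, hxy, hy⟩ :=
    (notMem_iff_exists_ne_and_isConjRoot hsep (Normal.splits inferInstance x)).1 hmem
  obtain ⟨σ, rfl⟩ := hy.symm.exists_algEquiv
  exact hxy (hfix σ).symm

variable {Ω : Type*} [Field Ω] {n : ℕ} {ζ β : Ω}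

/-- The `n`-th root `ζ ^ k * β` of `β ^ n` with label `k ∈ ℤ/n`, where `ζ` is an `n`-th root of
unity. -/
def kummerRoot (ζ β : Ω) (k : ZMod n) : Ω := ζ ^ k.val * β

theorem kummerRoot_zero : kummerRoot ζ β (0 : ZMod n) = β := by
  rw [kummerRoot, ZMod.val_zero, pow_zero, one_mul]

theorem kummerRoot_pow (hζ : ζ ^ n = 1) (k : ZMod n) : kummerRoot ζ β k ^ n = β ^ n := by
  rw [kummerRoot, mul_pow, pow_right_comm, hζ, one_pow, one_mul]

theorem kummerRoot_natCast (hζ : ζ ^ n = 1) (k : ℕ) :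
    kummerRoot ζ β (k : ZMod n) = ζ ^ k * β := by
  rw [kummerRoot, ZMod.val_natCast, ← pow_eq_pow_mod k hζ]

variable [NeZero n]

theorem kummerRoot_injective (hζ : IsPrimitiveRoot ζ n) (hβ : β ≠ 0) :
    Function.Injective (kummerRoot ζ β : ZMod n → Ω) := by
  intro k l h
  simpa using (pow_eq_pow_iff_natCast_eq hζ).1 (mul_right_cancel₀ hβ h)

variable {K : Type*} [Field K] [Algebra K Ω] {P : K}

theorem exists_apply_kummerRoot_eq_smul (hζ : IsPrimitiveRoot ζ n) (hβ : β ≠ 0)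
    (hP : β ^ n = algebraMap K Ω P) (σ : Gal(Ω/K)) :
    ∃ a : AffineZMod n, ∀ k : ZMod n, σ (kummerRoot ζ β k) = kummerRoot ζ β (a • k) := by
  obtain ⟨j, -, hj, hσζ⟩ := hζ.isPrimitiveRoot_iff.1 (hζ.map_of_injective σ.injective)
  obtain ⟨i, -, hσβ⟩ := hζ.eq_pow_of_pow_eq_one (ξ := σ β / β) (by
    rw [div_pow, ← map_pow, hP, AlgEquiv.commutes, ← hP, div_self (pow_ne_zero _ hβ)])
  refine ⟨.ofNat n i j hj, fun k => ?_⟩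
  have hk : AffineZMod.ofNat n i j hj • k = ((j * k.val + i : ℕ) : ZMod n) := by
    simp [AffineZMod.ofNat_smul]
  rw [hk, kummerRoot_natCast hζ.pow_eq_one, kummerRoot, map_mul, map_pow, ← hσζ, pow_add,
    pow_mul, mul_assoc, hσβ, div_mul_cancel₀ _ hβ]

/-- The Kummer representation: the action of `Gal(Ω/K)` on the `n`-th roots of `P`, written as a
homomorphism to the group of affine maps of their labels. -/
noncomputable def kummerHom (hζ : IsPrimitiveRoot ζ n) (hβ : β ≠ 0)
    (hP : β ^ n = algebraMap K Ω P) : Gal(Ω/K) →* AffineZMod n :=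
  have hspec σ := (exists_apply_kummerRoot_eq_smul hζ hβ hP σ).choose_spec
  { toFun σ := (exists_apply_kummerRoot_eq_smul hζ hβ hP σ).choose
    map_one' := eq_of_smul_eq_smul fun k => kummerRoot_injective hζ hβ <| by
      rw [← hspec, AlgEquiv.one_apply, one_smul]
    map_mul' σ τ := eq_of_smul_eq_smul fun k => kummerRoot_injective hζ hβ <| by
      rw [← hspec, AlgEquiv.mul_apply, hspec, hspec, mul_smul] }

variable (hζ : IsPrimitiveRoot ζ n) (hβ : β ≠ 0) (hP : β ^ n = algebraMap K Ω P) (σ : Gal(Ω/K))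

theorem galois_apply_kummerRoot (k : ZMod n) :
    σ (kummerRoot ζ β k) = kummerRoot ζ β (kummerHom hζ hβ hP σ • k) :=
  (exists_apply_kummerRoot_eq_smul hζ hβ hP σ).choose_spec k

theorem galois_apply_radical : σ β = ζ ^ (kummerHom hζ hβ hP σ).left.toAdd.val * β := by
  have h := galois_apply_kummerRoot hζ hβ hP σ 0
  rwa [kummerRoot_zero, AffineZMod.smul_def, mul_zero, zero_add, kummerRoot] at h

theorem galois_apply_rootOfUnity : σ ζ = ζ ^ ((kummerHom hζ hβ hP σ).right : ZMod n).val := by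
  set a := kummerHom hζ hβ hP σ with ha
  have h1 := galois_apply_kummerRoot hζ hβ hP σ (1 : ℕ)
  have h2 : a • ((1 : ℕ) : ZMod n) = ((a.right : ZMod n).val + a.left.toAdd.val : ℕ) := by
    simp [AffineZMod.smul_def]
  rw [← ha, h2, kummerRoot_natCast hζ.pow_eq_one, kummerRoot_natCast hζ.pow_eq_one, pow_one,
    map_mul, galois_apply_radical hζ hβ hP, pow_add, mul_assoc] at h1
  exact mul_right_cancel₀ (mul_ne_zero (pow_ne_zero _ (hζ.ne_zero (NeZero.ne n))) hβ) h1

/- For `σ = (s, q)` and `τ = (i, j)`, the commutator of `σ` and `τ` is the translation by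
`(q - 1) i - (j - 1) s`, which the number `c` of translations kills. Hence `t = -c s` works. -/
theorem exists_radical_fixed {σ : Gal(Ω/K)} {q : ℕ} (hq : 1 ≤ q)
    (hσ : ((kummerHom hζ hβ hP σ).right : ZMod n) = q) :
    ∃ t : ℕ, ∀ τ : Gal(Ω/K),
      τ (β ^ (Nat.card (AffineZMod.translations (kummerHom hζ hβ hP).range) * (q - 1)) * ζ ^ t) =
        β ^ (Nat.card (AffineZMod.translations (kummerHom hζ hβ hP).range) * (q - 1)) * ζ ^ t := by
  set c := Nat.card (AffineZMod.translations (kummerHom hζ hβ hP).range) with hc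
  set s : ZMod n := (kummerHom hζ hβ hP σ).left.toAdd with hs
  refine ⟨(-(c * s)).val, fun τ => ?_⟩
  rw [map_mul, map_pow, map_pow, galois_apply_radical hζ hβ hP, galois_apply_rootOfUnity hζ hβ hP,
    mul_pow, ← pow_mul, ← pow_mul, mul_right_comm, ← pow_add, mul_comm]
  congr 1
  rw [pow_eq_pow_iff_natCast_eq hζ]
  have hcomm := AffineZMod.card_translations_mul_commutator
    (Γ := (kummerHom hζ hβ hP).range) ⟨σ, rfl⟩ ⟨τ, rfl⟩
  rw [hσ, ← hs, ← hc] at hcomm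
  push_cast [hq]
  simp only [ZMod.natCast_val, ZMod.cast_id', id_eq]
  linear_combination hcomm

theorem exists_pow_eq_pow_card_translations [Normal K Ω] {σ : Gal(Ω/K)} {q : ℕ} (hq : 1 ≤ q)
    (hσ : ((kummerHom hζ hβ hP σ).right : ZMod n) = q) :
    ∃ γ : K,
      γ ^ n = P ^ (Nat.card (AffineZMod.translations (kummerHom hζ hβ hP).range) * (q - 1)) := by
  obtain ⟨t, ht⟩ := exists_radical_fixed hζ hβ hP hq hσ
  set e := Nat.card (AffineZMod.translations (kummerHom hζ hβ hP).range) * (q - 1)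
  have hpow : (β ^ e * ζ ^ t) ^ n = algebraMap K Ω (P ^ e) := by
    rw [mul_pow, pow_right_comm ζ, hζ.pow_eq_one, one_pow, mul_one, pow_right_comm, hP, map_pow]
  have hn : (n : K) ≠ 0 := by
    have := hζ.neZero'
    rw [← map_ne_zero (algebraMap K Ω), map_natCast]
    exact NeZero.ne (n : Ω)
  obtain ⟨γ, hγ⟩ := mem_range_algebraMap_of_pow_of_fixed hn hpow ht
  refine ⟨γ, (algebraMap K Ω).injective ?_⟩
  rw [map_pow, hγ, hpow]

end Kummer

section RootTower

variable {Ω : Type*} [Field Ω] {d : ℕ} {P : Ω}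

/-- Compatible systems of primitive `d ^ N`-th roots of unity `ζ N` and of `d ^ N`-th roots `β N`
of `P`. -/
structure RootTower (Ω : Type*) [Field Ω] (d : ℕ) (P : Ω) where
  ζ : ℕ → Ω
  β : ℕ → Ω
  isPrimitiveRoot : ∀ N, IsPrimitiveRoot (ζ N) (d ^ N)
  ζ_succ_pow : ∀ N, ζ (N + 1) ^ d = ζ N
  β_zero : β 0 = P
  β_succ_pow : ∀ N, β (N + 1) ^ d = β N

theorem exists_iterated_roots [IsAlgClosed Ω] (hd : d ≠ 0) (x : Ω) :
    ∃ r : ℕ → Ω, r 0 = x ∧ ∀ N, r (N + 1) ^ d = r N := by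
  choose root hroot using fun y : Ω => IsAlgClosed.exists_pow_nat_eq y (Nat.pos_of_ne_zero hd)
  exact ⟨fun N => root^[N] x, rfl, fun N => by simp only [Function.iterate_succ_apply', hroot]⟩

theorem isPrimitiveRoot_mul_of_pow {M : Type*} [CommMonoid M] {m : ℕ} {x : M}
    (hd : d ≠ 0) (hm : m ≠ 0) (hdm : d ∣ m) (h : IsPrimitiveRoot (x ^ d) m) :
    IsPrimitiveRoot x (m * d) := by
  refine IsPrimitiveRoot.iff_orderOf.2 (orderOf_eq_of_pow_and_pow_div_prime
    (Nat.mul_pos (Nat.pos_of_ne_zero hm) (Nat.pos_of_ne_zero hd)) ?_ fun p hp hpn hx => ?_)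
  · rw [mul_comm, pow_mul, h.pow_eq_one]
  have hpm : p ∣ m := (hp.dvd_mul.1 hpn).elim id fun hpd => hpd.trans hdm
  rw [← Nat.div_mul_right_comm hpm, mul_comm, pow_mul] at hx
  exact (Nat.div_lt_self (Nat.pos_of_ne_zero hm) hp.one_lt).not_ge
    (Nat.le_of_dvd (Nat.div_pos (Nat.le_of_dvd (Nat.pos_of_ne_zero hm) hpm) hp.pos)
      (h.dvd_of_pow_eq_one _ hx))

namespace RootTower

theorem nonempty [IsAlgClosed Ω] (hd : (d : Ω) ≠ 0) (P : Ω) : Nonempty (RootTower Ω d P) := by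
  have : NeZero (d : Ω) := ⟨hd⟩
  have hd' : d ≠ 0 := by
    rintro rfl
    exact hd Nat.cast_zero
  obtain ⟨ξ, hξ⟩ := HasEnoughRootsOfUnity.exists_primitiveRoot Ω d
  obtain ⟨η, hη0, hη⟩ := exists_iterated_roots hd' ξ
  obtain ⟨β, hβ0, hβ⟩ := exists_iterated_roots hd' P
  have hprim : ∀ N, IsPrimitiveRoot (η N) (d ^ (N + 1)) := by
    intro N
    induction N with
    | zero => rwa [hη0, zero_add, pow_one]
    | succ N ih =>
      rw [← hη N] at ih
      exact isPrimitiveRoot_mul_of_pow hd' (pow_ne_zero _ hd') (dvd_pow_self d N.succ_ne_zero) ih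
  exact ⟨{
    ζ := fun N => η N ^ d
    β := β
    isPrimitiveRoot := fun N => (hprim N).pow (pow_pos (Nat.pos_of_ne_zero hd') _) (pow_succ' d N)
    ζ_succ_pow := fun N => by rw [hη]
    β_zero := hβ0
    β_succ_pow := hβ }⟩

theorem β_pow (R : RootTower Ω d P) (N : ℕ) : R.β N ^ d ^ N = P := by
  induction N with
  | zero => rw [pow_zero, pow_one, R.β_zero]
  | succ N ih => rw [pow_succ', pow_mul, R.β_succ_pow, ih]

/-- The `d ^ N`-th root of `P` with label `k ∈ ℤ/d^N`. -/
def point (R : RootTower Ω d P) (N : ℕ) (k : ZMod (d ^ N)) : Ω := kummerRoot (R.ζ N) (R.β N) k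

theorem point_pow (R : RootTower Ω d P) (N : ℕ) (k : ZMod (d ^ N)) :
    R.point N k ^ d ^ N = P := by
  rw [point, kummerRoot_pow (R.isPrimitiveRoot N).pow_eq_one, R.β_pow]

theorem point_injective [NeZero d] (R : RootTower Ω d P) (hP : P ≠ 0) (N : ℕ) :
    Function.Injective (R.point N) :=
  kummerRoot_injective (R.isPrimitiveRoot N) fun h =>
    hP (by rw [← R.β_pow N, h, zero_pow (NeZero.ne _)])

theorem point_succ_pow [NeZero d] (R : RootTower Ω d P) (N : ℕ) (k : ZMod (d ^ (N + 1))) :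
    R.point (N + 1) k ^ d =
      R.point N (ZMod.castHom (pow_dvd_pow d (Nat.le_succ N)) (ZMod (d ^ N)) k) := by
  rw [point, point, ZMod.castHom_apply, ZMod.cast_eq_val,
    kummerRoot_natCast (R.isPrimitiveRoot N).pow_eq_one, kummerRoot, mul_pow, pow_right_comm,
    R.ζ_succ_pow, R.β_succ_pow]

end RootTower

end RootTower

section LeadingTerm

variable {Ω Γ₀ : Type*} [Field Ω] [LinearOrderedCommGroupWithZero Γ₀] {v : Valuation Ω Γ₀}
  {x y z : Ω}

/-- Two nonzero elements of a valued field have the same leading term if their quotient is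
congruent to `1` modulo the maximal ideal of the valuation ring. -/
def SameLeadingTerm (v : Valuation Ω Γ₀) (x y : Ω) : Prop := v (x - y) < v x

namespace SameLeadingTerm

theorem refl (hx : v x ≠ 0) : SameLeadingTerm v x x := by
  rw [SameLeadingTerm, sub_self, map_zero]
  exact zero_lt_iff.2 hx

theorem map_eq (h : SameLeadingTerm v x y) : v y = v x := by
  rw [SameLeadingTerm, v.map_sub_swap] at h
  simpa using v.map_add_eq_of_lt_right h

theorem symm (h : SameLeadingTerm v x y) : SameLeadingTerm v y x := by
  rwa [SameLeadingTerm, h.map_eq, v.map_sub_swap]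

theorem trans (h : SameLeadingTerm v x y) (h' : SameLeadingTerm v y z) :
    SameLeadingTerm v x z := by
  have := v.map_add_lt h (h'.trans_eq h.map_eq)
  rwa [sub_add_sub_cancel] at this

theorem mul {x' y' : Ω} (h : SameLeadingTerm v x y) (h' : SameLeadingTerm v x' y') :
    SameLeadingTerm v (x * x') (y * y') := by
  have hx' : 0 < v x' := zero_le.trans_lt h'
  have hx : 0 < v x := zero_le.trans_lt h
  rw [SameLeadingTerm, show x * x' - y * y' = x * (x' - y') + (x - y) * y' by ring, map_mul]
  refine v.map_add_lt ?_ ?_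
  · rw [map_mul]
    exact mul_lt_mul_of_pos_left h' hx
  · rw [map_mul, h'.map_eq]
    exact mul_lt_mul_of_pos_right h hx'

theorem pow (h : SameLeadingTerm v x y) (m : ℕ) : SameLeadingTerm v (x ^ m) (y ^ m) := by
  induction m with
  | zero => simpa only [pow_zero] using refl (by simp)
  | succ m ih => simpa only [pow_succ] using ih.mul h

theorem eq_one_of_pow_eq_one {m : ℕ} (hm : v m = 1) (h : SameLeadingTerm v 1 y)
    (hy : y ^ m = 1) : y = 1 := by
  have hsum : v (∑ i ∈ Finset.range m, y ^ i) = 1 := by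
    have hlt : v (∑ i ∈ Finset.range m, (y ^ i - 1)) < 1 := v.map_sum_lt one_ne_zero fun i _ => by
      simpa only [SameLeadingTerm, one_pow, v.map_sub_swap, map_one] using h.pow i
    rw [Finset.sum_sub_distrib, Finset.sum_const, Finset.card_range, nsmul_one, ← hm] at hlt
    simpa only [sub_add_cancel, hm] using v.map_add_eq_of_lt_right hlt
  have hmul := geom_sum_mul y m
  rw [hy, sub_self, mul_eq_zero, sub_eq_zero] at hmul
  refine hmul.resolve_left fun h0 => ?_
  rw [h0, map_zero] at hsum
  exact zero_ne_one hsum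

theorem eq_of_pow_eq {m : ℕ} (hm : v m = 1) (h : SameLeadingTerm v x y) (hxy : x ^ m = y ^ m) :
    x = y := by
  have hx : x ≠ 0 := v.ne_zero_iff.1 (zero_le.trans_lt h).ne'
  have hquot : SameLeadingTerm v 1 (y / x) := by
    simpa only [inv_mul_cancel₀ hx, inv_mul_eq_div] using
      (refl (v := v) (x := x⁻¹) (by simpa using hx)).mul h
  have hone := hquot.eq_one_of_pow_eq_one hm (by rw [div_pow, ← hxy, div_self (pow_ne_zero _ hx)])
  exact ((div_eq_one_iff_eq hx).1 hone).symm

end SameLeadingTerm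

theorem exists_mem_roots_map_sub_lt [IsAlgClosed Ω] (v : Valuation Ω Γ₀) {g : Polynomial Ω}
    (hg : g.Monic) {c : Γ₀} (h : v (g.eval y) < c ^ g.natDegree) :
    ∃ x ∈ g.roots, v (y - x) < c := by
  have hs := IsAlgClosed.splits g
  by_contra! hc
  refine h.not_ge ?_
  rw [hs.natDegree_eq_card_roots, hs.eval_eq_prod_roots_of_monic hg, map_multiset_prod,
    Multiset.map_map, ← Multiset.card_map (v ∘ fun x => y - x) g.roots]
  exact Multiset.pow_card_le_prod (Multiset.forall_mem_map_iff.2 hc)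

end LeadingTerm

section Escape

variable {K : Type*} [Field K] {Γ₀ : Type*} [LinearOrderedCommGroupWithZero Γ₀]
  {f : K[X]} {Ω : Type*} [Field Ω] [Algebra K Ω] {v : Valuation Ω Γ₀} {x : Ω}

theorem sameLeadingTerm_pow_aeval (hf : f.Monic) (hc : ∀ i, v (algebraMap K Ω (f.coeff i)) ≤ 1)
    (hx : 1 < v x) : SameLeadingTerm v (x ^ f.natDegree) (aeval x f) := by
  rw [SameLeadingTerm, v.map_sub_swap, aeval_eq_sum_range, Finset.sum_range_succ,
    hf.coeff_natDegree, one_smul, add_sub_cancel_right, map_pow]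
  refine v.map_sum_lt (pow_ne_zero _ (zero_lt_one.trans hx).ne') fun i hi => ?_
  rw [Algebra.smul_def, map_mul, map_pow]
  exact (mul_le_of_le_one_left' (hc i)).trans_lt (pow_lt_pow_right₀ hx (Finset.mem_range.1 hi))

theorem map_aeval_le_one (hc : ∀ i, v (algebraMap K Ω (f.coeff i)) ≤ 1) (hx : v x ≤ 1) :
    v (aeval x f) ≤ 1 := by
  rw [aeval_eq_sum_range]
  refine v.map_sum_le fun i _ => ?_
  rw [Algebra.smul_def, map_mul, map_pow]
  exact mul_le_one' (hc i) (pow_le_one' hx i)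

theorem one_lt_map_aeval_iff (hf : f.Monic) (hd : f.natDegree ≠ 0)
    (hc : ∀ i, v (algebraMap K Ω (f.coeff i)) ≤ 1) : 1 < v (aeval x f) ↔ 1 < v x := by
  refine ⟨fun h => not_le.1 fun hx => h.not_ge (map_aeval_le_one hc hx), fun hx => ?_⟩
  rw [(sameLeadingTerm_pow_aeval hf hc hx).map_eq, map_pow]
  exact one_lt_pow' hx hd

theorem one_lt_map_iterate_aeval_iff (hf : f.Monic) (hd : f.natDegree ≠ 0)
    (hc : ∀ i, v (algebraMap K Ω (f.coeff i)) ≤ 1) (N : ℕ) :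
    1 < v ((fun z => aeval z f)^[N] x) ↔ 1 < v x := by
  induction N generalizing x with
  | zero => rfl
  | succ N ih => rw [Function.iterate_succ_apply, ih, one_lt_map_aeval_iff hf hd hc]

theorem sameLeadingTerm_pow_iterate_aeval (hf : f.Monic) (hd : f.natDegree ≠ 0)
    (hc : ∀ i, v (algebraMap K Ω (f.coeff i)) ≤ 1) (hx : 1 < v x) (N : ℕ) :
    SameLeadingTerm v (x ^ f.natDegree ^ N) ((fun z => aeval z f)^[N] x) := by
  induction N generalizing x with
  | zero => simpa only [pow_zero, pow_one] using .refl (zero_lt_one.trans hx).ne'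
  | succ N ih =>
    rw [Function.iterate_succ_apply, pow_succ', pow_mul]
    exact ((sameLeadingTerm_pow_aeval hf hc hx).pow _).trans
      (ih ((one_lt_map_aeval_iff hf hd hc).2 hx))

/-- The polynomial `f^N - P`, whose roots are the nodes at level `N`. -/
noncomputable def nodePolynomial (f : K[X]) (P : K) (N : ℕ) : K[X] := f.comp^[N] X - C P

theorem aeval_nodePolynomial (f : K[X]) (P : K) (N : ℕ) (x : Ω) :
    aeval x (nodePolynomial f P N) = (fun z => aeval z f)^[N] x - algebraMap K Ω P := by
  rw [nodePolynomial, map_sub, aeval_C, aeval_def, iterate_comp_eval₂, eval₂_X]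
  rfl

theorem natDegree_nodePolynomial (f : K[X]) (P : K) (N : ℕ) :
    (nodePolynomial f P N).natDegree = f.natDegree ^ N := by
  rw [nodePolynomial, natDegree_sub_C, natDegree_iterate_comp, natDegree_X, mul_one]

theorem monic_nodePolynomial (hf : f.Monic) (hd : f.natDegree ≠ 0) (P : K) (N : ℕ) :
    (nodePolynomial f P N).Monic := by
  have hdeg : ∀ N, (f.comp^[N] X).natDegree = f.natDegree ^ N := fun N => by
    rw [natDegree_iterate_comp, natDegree_X, mul_one]
  have hmonic : (f.comp^[N] X).Monic := by
    induction N with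
    | zero => exact monic_X
    | succ N ih =>
      rw [Function.iterate_succ_apply']
      exact hf.comp ih (by rw [hdeg]; exact pow_ne_zero _ hd)
  refine hmonic.sub_of_left (degree_C_le.trans_lt (natDegree_pos_iff_degree_pos.1 ?_))
  rw [hdeg]
  exact pow_pos (Nat.pos_of_ne_zero hd) N

theorem exists_sameLeadingTerm_iterate_aeval_eq [IsAlgClosed Ω] (hf : f.Monic)
    (hd : f.natDegree ≠ 0) (hc : ∀ i, v (algebraMap K Ω (f.coeff i)) ≤ 1) {P : K} {N : ℕ} {y : Ω}
    (hy : 1 < v y) (hyP : y ^ f.natDegree ^ N = algebraMap K Ω P) :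
    ∃ x : Ω, (fun z => aeval z f)^[N] x = algebraMap K Ω P ∧ SameLeadingTerm v y x := by
  have hm := monic_nodePolynomial hf hd P N
  have hsmall : v (((nodePolynomial f P N).map (algebraMap K Ω)).eval y) <
      v y ^ ((nodePolynomial f P N).map (algebraMap K Ω)).natDegree := by
    rw [eval_map_algebraMap, aeval_nodePolynomial, natDegree_map, natDegree_nodePolynomial,
      v.map_sub_swap, ← map_pow, ← hyP]
    exact sameLeadingTerm_pow_iterate_aeval hf hd hc hy N
  obtain ⟨x, hx, hyx⟩ := exists_mem_roots_map_sub_lt v (hm.map _) hsmall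
  rw [mem_roots (hm.map _).ne_zero, IsRoot.def, eval_map_algebraMap, aeval_nodePolynomial,
    sub_eq_zero] at hx
  exact ⟨x, hx, hyx⟩

end Escape

theorem mem_filledJulia_of_norm_le_one {K : Type*} [NormedField K] [IsUltrametricDist K] {f : K[X]}
    (hf : HasGoodReduction f) {P : K} (hP : ‖P‖ ≤ 1) : P ∈ filledJulia f := by
  refine isBounded_iff_forall_norm_le.2 ⟨1, ?_⟩
  rintro _ ⟨n, rfl⟩
  refine Function.Iterate.rec (fun x => ‖x‖ ≤ 1) hP (fun x hx => ?_) n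
  rw [← coe_aeval_eq_eval]
  exact map_aeval_le_one (v := NormedField.valuation) hf hx

section RootTower

variable {Ω Γ₀ : Type*} [Field Ω] [LinearOrderedCommGroupWithZero Γ₀] {v : Valuation Ω Γ₀}
  {d N : ℕ} {P : Ω}

theorem ne_zero_of_map_natCast_eq_one (h : v d = 1) : d ≠ 0 := by
  rintro rfl
  simp at h

theorem RootTower.one_lt_map_point (R : RootTower Ω d P) (hP : 1 < v P) (k : ZMod (d ^ N)) :
    1 < v (R.point N k) := by
  by_contra! h
  rw [← R.point_pow N k, map_pow] at hP
  exact hP.not_ge (pow_le_one' h _)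

theorem RootTower.eq_of_sameLeadingTerm (R : RootTower Ω d P) (hvd : v d = 1) (hP : P ≠ 0)
    {k l : ZMod (d ^ N)} {z : Ω} (hk : SameLeadingTerm v (R.point N k) z)
    (hl : SameLeadingTerm v (R.point N l) z) : k = l := by
  have : NeZero d := ⟨ne_zero_of_map_natCast_eq_one hvd⟩
  have hvdN : v (d ^ N : ℕ) = 1 := by rw [Nat.cast_pow, map_pow, hvd, one_pow]
  exact R.point_injective hP N ((hk.trans hl.symm).eq_of_pow_eq hvdN
    ((R.point_pow N k).trans (R.point_pow N l).symm))

end RootTower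

section Labelling

variable {K : Type*} [Field K] {f : K[X]} {P : K}

/-- The nodes at level `N` of the tree of iterated preimages are the roots of `f^N - P`. -/
def nodeEquivRootSet (hf : f.Monic) (hd : f.natDegree ≠ 0) (P : K) (N : ℕ) :
    (preimageTree f P).node N ≃ (nodePolynomial f P N).rootSet (AlgebraicClosure K) :=
  Equiv.subtypeEquivRight fun x => by
    rw [mem_rootSet_of_ne (monic_nodePolynomial hf hd P N).ne_zero, aeval_nodePolynomial,
      sub_eq_zero]

theorem finite_node (hf : f.Monic) (hd : f.natDegree ≠ 0) (P : K) (N : ℕ) :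
    Finite ((preimageTree f P).node N) :=
  .of_equiv _ (nodeEquivRootSet hf hd P N).symm

theorem card_node_le (hf : f.Monic) (hd : f.natDegree ≠ 0) (P : K) (N : ℕ) :
    Nat.card ((preimageTree f P).node N) ≤ f.natDegree ^ N := by
  rw [Nat.card_congr (nodeEquivRootSet hf hd P N), Nat.card_coe_set_eq,
    ← natDegree_nodePolynomial f P N]
  exact ncard_rootSet_le _ _

variable {Γ₀ : Type*} [LinearOrderedCommGroupWithZero Γ₀] {v : Valuation (AlgebraicClosure K) Γ₀}

theorem exists_equiv_node_sameLeadingTerm (hf : f.Monic)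
    (hc : ∀ i, v (algebraMap K _ (f.coeff i)) ≤ 1) (hvd : v f.natDegree = 1)
    (hP : 1 < v (algebraMap K _ P))
    (R : RootTower (AlgebraicClosure K) f.natDegree (algebraMap K _ P)) (N : ℕ) :
    ∃ α : ZMod (f.natDegree ^ N) ≃ (preimageTree f P).node N,
      ∀ k x, SameLeadingTerm v (R.point N k) x.1 ↔ x = α k := by
  have hd := ne_zero_of_map_natCast_eq_one hvd
  have hP0 : algebraMap K (AlgebraicClosure K) P ≠ 0 := v.ne_zero_iff.1 (zero_lt_one.trans hP).ne'
  have := finite_node hf hd P N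
  have hex : ∀ k, ∃ x : (preimageTree f P).node N, SameLeadingTerm v (R.point N k) x.1 := by
    intro k
    obtain ⟨x, hx, hkx⟩ := exists_sameLeadingTerm_iterate_aeval_eq hf hd hc
      (R.one_lt_map_point hP k) (R.point_pow N k)
    exact ⟨⟨x, hx⟩, hkx⟩
  choose α hα using hex
  have hinj : Function.Injective α := fun k l h =>
    R.eq_of_sameLeadingTerm hvd hP0 (hα k) (h ▸ hα l)
  have hbij : Function.Bijective α := hinj.bijective_of_nat_card_le (by
    rw [Nat.card_zmod]
    exact card_node_le hf hd P N)
  refine ⟨.ofBijective α hbij, fun k x => ⟨fun hk => ?_, ?_⟩⟩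
  · obtain ⟨l, rfl⟩ := hbij.2 x
    rw [R.eq_of_sameLeadingTerm hvd hP0 hk (hα l)]
    rfl
  · rintro rfl
    exact hα k

theorem exists_consistentLabelling_sameLeadingTerm (hf : f.Monic)
    (hc : ∀ i, v (algebraMap K _ (f.coeff i)) ≤ 1) (hvd : v f.natDegree = 1)
    (hP : 1 < v (algebraMap K _ P))
    (R : RootTower (AlgebraicClosure K) f.natDegree (algebraMap K _ P)) :
    ∃ L : (preimageTree f P).ConsistentLabelling f.natDegree,
      ∀ N k x, SameLeadingTerm v (R.point N k) x.1 ↔ x = L.α N k := by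
  have hd := ne_zero_of_map_natCast_eq_one hvd
  have : NeZero f.natDegree := ⟨hd⟩
  choose α hα using exists_equiv_node_sameLeadingTerm hf hc hvd hP R
  refine ⟨⟨α, fun N k => ?_⟩, hα⟩
  have hlarge : 1 < v (α (N + 1) k).1 := by
    rwa [← one_lt_map_iterate_aeval_iff hf hd hc (N + 1), (α (N + 1) k).2]
  have hterm := (((hα (N + 1) k _).2 rfl).pow _).trans (sameLeadingTerm_pow_aeval hf hc hlarge)
  rw [R.point_succ_pow] at hterm
  exact (hα N _ _).1 hterm

theorem restrict_arborealRep_label (hv : ∀ (σ : Gal(AlgebraicClosure K/K)) x, v (σ x) = v x)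
    {d : ℕ} {R : RootTower (AlgebraicClosure K) d (algebraMap K _ P)}
    {L : (preimageTree f P).ConsistentLabelling d}
    (hL : ∀ N k x, SameLeadingTerm v (R.point N k) x.1 ↔ x = L.α N k)
    {σ : Gal(AlgebraicClosure K/K)} {N : ℕ} {k l : ZMod (d ^ N)}
    (h : σ (R.point N k) = R.point N l) :
    (preimageTree f P).restrict N (arborealRep f P σ) (L.α N k) = L.α N l := by
  rw [← hL, ← h]
  change v (σ (R.point N k) - σ (L.α N k).1) < _
  rw [← map_sub, hv, hv]
  exact (hL N k _).2 rfl

end Labelling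

section ClosedImage

theorem exists_algEquiv_of_monotone {K Ω : Type*} [Field K] [Field Ω] [Algebra K Ω] [Normal K Ω]
    {E : ℕ → IntermediateField K Ω} (hE : Monotone E) {σ : ℕ → Gal(Ω/K)}
    (hσ : ∀ N, ∀ x ∈ E N, σ (N + 1) x = σ N x) : ∃ τ : Gal(Ω/K), ∀ N, ∀ x ∈ E N, τ x = σ N x := by
  let lifts (N : ℕ) : Lifts K Ω Ω := ⟨E N, (σ N : Ω →ₐ[K] Ω).comp (E N).val⟩
  have hlifts : Monotone lifts := monotone_nat_of_le_succ fun N =>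
    ⟨hE N.le_succ, fun x => hσ N x x.2⟩
  obtain ⟨u, hu⟩ := Lifts.exists_upper_bound _ hlifts.isChain_range
  obtain ⟨τ, hτ⟩ := exists_algHom_of_splits
    (fun s => ⟨Normal.isIntegral ‹_› s, Normal.splits ‹_› s⟩) u.emb
  refine ⟨.ofBijective τ (Algebra.IsAlgebraic.algHom_bijective τ), fun N x hx => ?_⟩
  obtain ⟨hle, hemb⟩ := hu (lifts N) ⟨N, rfl⟩
  exact (DFunLike.congr_fun hτ ⟨x, hle hx⟩).trans (hemb ⟨x, hx⟩)

variable {K : Type*} [Field K] {f : K[X]} {P : K}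

theorem mem_range_arborealRep (hT : ∀ N, Function.Surjective ((preimageTree f P).parent N))
    (g : (preimageTree f P).Aut)
    (hg : ∀ N, (preimageTree f P).restrict N g ∈
      (arborealRep f P).range.map ((preimageTree f P).restrict N)) :
    g ∈ (arborealRep f P).range := by
  have hex : ∀ N, ∃ σ, (preimageTree f P).restrict N (arborealRep f P σ) =
      (preimageTree f P).restrict N g := fun N => by
    obtain ⟨_, ⟨σ, rfl⟩, hσ⟩ := hg N
    exact ⟨σ, hσ⟩
  choose σ hσ using hex
  let nodes (N : ℕ) : Set (AlgebraicClosure K) :=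
    Set.range (Subtype.val : (preimageTree f P).node N → _)
  have hmono : Monotone fun N => adjoin K (nodes N) := monotone_nat_of_le_succ fun N => by
    rw [adjoin_le_iff]
    rintro _ ⟨x, rfl⟩
    obtain ⟨y, rfl⟩ := hT N x
    rw [show ((preimageTree f P).parent N y).1 = aeval y.1 f from rfl,
      show y.1 = (⟨y.1, subset_adjoin K _ ⟨y, rfl⟩⟩ : adjoin K (nodes (N + 1))) from rfl,
      aeval_coe]
    exact SetLike.coe_mem _
  have hagree : ∀ N, ∀ x ∈ adjoin K (nodes N), σ (N + 1) x = σ N x := by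
    intro N x hx
    have hext : (σ (N + 1)).toAlgHom.comp (adjoin K (nodes N)).val =
        (σ N).toAlgHom.comp (adjoin K (nodes N)).val := by
      refine adjoin_algHom_ext K ?_
      rintro _ ⟨z, rfl⟩
      have hker := (preimageTree f P).antitone_ker_restrict hT N.le_succ
        ((MonoidHom.eq_iff _).1 (hσ (N + 1)))
      have hres := (MonoidHom.eq_iff _).2 hker
      exact congrArg Subtype.val (DFunLike.congr_fun (hres.trans (hσ N).symm) z)
    exact DFunLike.congr_fun hext ⟨x, hx⟩
  obtain ⟨τ, hτ⟩ := exists_algEquiv_of_monotone hmono hagree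
  refine ⟨τ, Subtype.ext (funext fun N => Equiv.ext fun x => Subtype.ext ?_)⟩
  exact (hτ N x.1 (subset_adjoin K _ ⟨x, rfl⟩)).trans
    (congrArg Subtype.val (DFunLike.congr_fun (hσ N) x))

end ClosedImage

section Frobenius

variable {A K : Type*} [CommRing A] [IsDomain A] [IsNoetherianRing A] [IsIntegrallyClosed A]
  [Field K] [Algebra A K] [IsFractionRing A K] (p : Ideal A) [p.IsMaximal] [Finite (A ⧸ p)]

theorem exists_galois_apply_eq_pow_card_quotient {L : Type*} [Field L] [Algebra K L] [Algebra A L]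
    [IsScalarTower A K L] [FiniteDimensional K L] [IsGalois K L] {m : ℕ} (hm : (m : A) ∉ p) {ζ : L}
    (hζ : ζ ^ m = 1) : ∃ σ : Gal(L/K), σ ζ = ζ ^ Nat.card (A ⧸ p) := by
  let S := integralClosure A L
  have : FaithfulSMul A L := .trans A K L
  have : IsFractionRing S L := integralClosure.isFractionRing_of_finite_extension K L
  have : SMulCommClass Gal(L/K) A L := ⟨fun σ a x => by
    rw [← algebraMap_smul K a x, ← algebraMap_smul K a (σ • x), smul_comm]⟩
  have : IsGaloisGroup Gal(L/K) A S := .of_isFractionRing Gal(L/K) A S K L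
  have : Algebra.IsInvariant A S Gal(L/K) := IsGaloisGroup.isInvariant
  have := IsIntegralClosure.finite A K L S
  obtain ⟨Q, hQ, hQp⟩ := Ideal.exists_maximal_ideal_liesOver_of_isIntegral (S := S) p
  have : Finite (S ⧸ Q) := Module.finite_of_finite (A ⧸ p)
  obtain ⟨σ, hσ⟩ := IsArithFrobAt.exists_of_isInvariant A Gal(L/K) Q
  have hm0 : m ≠ 0 := by
    rintro rfl
    simp at hm
  have hint : IsIntegral A ζ := .of_pow (Nat.pos_of_ne_zero hm0) (hζ ▸ isIntegral_one)
  have hmQ : (m : S) ∉ Q := by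
    rwa [← map_natCast (algebraMap A S), ← Ideal.mem_of_liesOver Q p]
  have hfrob := hσ.apply_of_pow_eq_one (ζ := ⟨ζ, hint⟩) (Subtype.ext hζ) hmQ
  rw [← Ideal.over_def Q p] at hfrob
  exact ⟨σ, congrArg Subtype.val hfrob⟩

theorem exists_galois_algebraicClosure_apply_eq_pow_card_quotient {m : ℕ} (hm : (m : A) ∉ p)
    {ζ : AlgebraicClosure K} (hζ : IsPrimitiveRoot ζ m) :
    ∃ σ : Gal(AlgebraicClosure K/K), σ ζ = ζ ^ Nat.card (A ⧸ p) := by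
  have : NeZero m := ⟨by rintro rfl; simp at hm⟩
  have := hζ.intermediateField_adjoin_isCyclotomicExtension K
  have : IsGalois K K⟮ζ⟯ := IsCyclotomicExtension.isGalois {m} K K⟮ζ⟯
  have : FiniteDimensional K K⟮ζ⟯ := IsCyclotomicExtension.finiteDimensional {m} K K⟮ζ⟯
  obtain ⟨τ, hτ⟩ := exists_galois_apply_eq_pow_card_quotient (K := K) p hm
    (ζ := AdjoinSimple.gen K ζ) (Subtype.ext hζ.pow_eq_one)
  refine ⟨τ.liftNormal (AlgebraicClosure K), ?_⟩
  have hlift := τ.liftNormal_commutes (AlgebraicClosure K) (AdjoinSimple.gen K ζ)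
  rw [hτ] at hlift
  exact hlift

end Frobenius

section Discrete

open WithZero IsDiscreteValuationRing

theorem exists_dvd_mul_of_pow_eq_pow {A K : Type*} [CommRing A] [IsDomain A]
    [IsDiscreteValuationRing A] [Field K] [Algebra A K] [IsFractionRing A K] {P : K}
    (hP : P ∉ (algebraMap A K).range) :
    ∃ m ≠ 0, ∀ (n e : ℕ) (γ : K), γ ^ n = P ^ e → n ∣ m * e := by
  let v := (maximalIdeal A).valuation K
  have hv : 1 < v P := lt_of_not_ge fun h => hP (exists_lift_of_le_one h)
  refine ⟨(log (v P)).natAbs, ?_, fun n e γ h => ?_⟩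
  · rw [Int.natAbs_ne_zero]
    exact ((log_lt_log one_ne_zero (zero_lt_one.trans hv).ne').2 hv).ne'
  · have hlog : n • log (v γ) = e • log (v P) := by
      rw [← log_pow, ← map_pow, h, map_pow, log_pow]
    rw [nsmul_eq_mul, nsmul_eq_mul] at hlog
    have hnat := congrArg Int.natAbs hlog
    rw [Int.natAbs_mul, Int.natAbs_mul, Int.natAbs_natCast, Int.natAbs_natCast] at hnat
    exact ⟨(log (v γ)).natAbs, by rw [hnat, mul_comm]⟩

end Discrete

section LocalField

open Valued.integer
open scoped NormedField Valued

variable {K : Type*} [NontriviallyNormedField K] [IsUltrametricDist K]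

theorem isDiscreteValuationRing_and_finite_residueField [ProperSpace K] :
    IsDiscreteValuationRing 𝒪[K] ∧ Finite 𝓀[K] := by
  have : (Valued.v : Valuation K NNReal).RankOne :=
    inferInstanceAs (NormedField.valuation (K := K)).RankOne
  have : CompactSpace 𝒪[K] := isCompact_iff_compactSpace.1 <| by
    convert isCompact_closedBall (0 : K) 1
    ext x
    rw [SetLike.mem_coe, mem_iff, mem_closedBall_zero_iff]
  exact (compactSpace_iff_completeSpace_and_isDiscreteValuationRing_and_finite_residueField.1
    ‹_›).2

theorem exists_galois_invariant_valuation [CompleteSpace K] :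
    ∃ v : Valuation (AlgebraicClosure K) NNReal,
      (∀ x : K, v (algebraMap K _ x) = ‖x‖₊) ∧
      ∀ (σ : Gal(AlgebraicClosure K/K)) x, v (σ x) = v x := by
  let := spectralNorm.normedField K (AlgebraicClosure K)
  have : IsUltrametricDist (AlgebraicClosure K) :=
    IsUltrametricDist.isUltrametricDist_of_isNonarchimedean_norm isNonarchimedean_spectralNorm
  refine ⟨NormedField.valuation, fun x => NNReal.eq ?_, fun σ x => NNReal.eq ?_⟩
  · exact spectralNorm_extends x
  · exact (spectralNorm_eq_of_equiv σ x).symm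

theorem exists_dvd_mul_of_pow_eq_pow_of_one_lt_norm [ProperSpace K] {P : K} (hP : 1 < ‖P‖) :
    ∃ m ≠ 0, ∀ (n e : ℕ) (γ : K), γ ^ n = P ^ e → n ∣ m * e := by
  have := (isDiscreteValuationRing_and_finite_residueField (K := K)).1
  refine exists_dvd_mul_of_pow_eq_pow (A := 𝒪[K]) ?_
  rintro ⟨x, rfl⟩
  exact hP.not_ge (Valued.integer.norm_le_one x)

theorem exists_galois_apply_eq_pow_card_residueField [ProperSpace K] {m : ℕ} (hm : ‖(m : K)‖ = 1)
    {ζ : AlgebraicClosure K} (hζ : IsPrimitiveRoot ζ m) :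
    ∃ σ : Gal(AlgebraicClosure K/K), σ ζ = ζ ^ Nat.card 𝓀[K] := by
  obtain ⟨_, hfin⟩ := isDiscreteValuationRing_and_finite_residueField (K := K)
  have : Finite (𝒪[K] ⧸ 𝓂[K]) := hfin
  refine exists_galois_algebraicClosure_apply_eq_pow_card_quotient 𝓂[K] ?_ hζ
  rw [IsLocalRing.notMem_maximalIdeal, Valued.integer.isUnit_iff_norm_eq_one]
  exact hm

end LocalField

namespace RootTower

variable {K Ω : Type*} [Field K] [Field Ω] [Algebra K Ω] {d : ℕ} [NeZero d] {P : K}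
  (R : RootTower Ω d (algebraMap K Ω P))

theorem β_ne_zero (hP : P ≠ 0) (N : ℕ) : R.β N ≠ 0 := by
  intro h
  have hpow := R.β_pow N
  rw [h, zero_pow (NeZero.ne _)] at hpow
  exact hP ((map_eq_zero _).1 hpow.symm)

variable (hP : P ≠ 0)

/-- The action of `Gal(Ω/K)` on the labels of the `d ^ N`-th roots of `P`. -/
noncomputable def galoisAffine (N : ℕ) : Gal(Ω/K) →* AffineZMod (d ^ N) :=
  kummerHom (R.isPrimitiveRoot N) (R.β_ne_zero hP N) (R.β_pow N)

theorem apply_point (σ : Gal(Ω/K)) (N : ℕ) (k : ZMod (d ^ N)) :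
    σ (R.point N k) = R.point N (R.galoisAffine hP N σ • k) :=
  galois_apply_kummerRoot (R.isPrimitiveRoot N) (R.β_ne_zero hP N) (R.β_pow N) σ k

theorem galoisAffine_right_eq_natCast {σ : Gal(Ω/K)} {N q : ℕ} (hσ : σ (R.ζ N) = R.ζ N ^ q) :
    ((R.galoisAffine hP N σ).right : ZMod (d ^ N)) = q := by
  rw [galois_apply_rootOfUnity (R.isPrimitiveRoot N) (R.β_ne_zero hP N) (R.β_pow N) σ,
    pow_eq_pow_iff_natCast_eq (R.isPrimitiveRoot N), ZMod.natCast_zmod_val] at hσ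
  exact hσ

theorem exists_index_range_galoisAffine_le [Normal K Ω] {q m : ℕ} (hq : 2 ≤ q)
    (hfrob : ∀ N, ∃ σ : Gal(Ω/K), σ (R.ζ N) = R.ζ N ^ q) (hm : m ≠ 0)
    (hdvd : ∀ (n e : ℕ) (γ : K), γ ^ n = P ^ e → n ∣ m * e) :
    ∃ C, ∀ N, (R.galoisAffine hP N).range.index ≤ C := by
  choose σ hσ using hfrob
  have hright := fun N => R.galoisAffine_right_eq_natCast hP (hσ N)
  have hqd : q.Coprime d := by
    have hunit := (R.galoisAffine hP 1 (σ 1)).right.isUnit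
    rwa [hright, ZMod.isUnit_iff_coprime, pow_one] at hunit
  obtain ⟨c, hc, horder⟩ := exists_pow_dvd_mul_orderOf hq hqd
  refine ⟨m * (q - 1) * c, fun N => ?_⟩
  obtain ⟨γ, hγ⟩ := exists_pow_eq_pow_card_translations _ _ _ (one_le_two.trans hq) (hright N)
  refine AffineZMod.index_le (MonoidHom.mem_range.2 ⟨σ N, rfl⟩)
    (mul_ne_zero hm (Nat.sub_ne_zero_of_lt hq)) hc ?_ (horder N _ (hright N))
  rw [mul_assoc, mul_comm (q - 1)]
  exact hdvd _ _ γ hγ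

end RootTower

section ArborealImage

variable {K : Type*} [Field K] {f : K[X]} {P : K} {d : ℕ}
  {L : (preimageTree f P).ConsistentLabelling d}
  {a : ∀ N, Gal(AlgebraicClosure K/K) →* AffineZMod (d ^ N)}

theorem range_arborealRep_le_affineGroup
    (ha : ∀ N σ, (preimageTree f P).restrict N (arborealRep f P σ) = L.affine N (a N σ)) :
    (arborealRep f P).range ≤ L.affineGroup := by
  rintro _ ⟨σ, rfl⟩
  exact L.mem_affineGroup.2 fun N => ⟨a N σ, (ha N σ).symm⟩

theorem relIndex_map_restrict_range_arborealRep (hd : d ≠ 0)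
    (ha : ∀ N σ, (preimageTree f P).restrict N (arborealRep f P σ) = L.affine N (a N σ)) (N : ℕ) :
    ((arborealRep f P).range.map ((preimageTree f P).restrict N)).relIndex
      (L.affineGroup.map ((preimageTree f P).restrict N)) = (a N).range.index := by
  have hcomp : ((preimageTree f P).restrict N).comp (arborealRep f P) =
      (L.affine N).comp (a N) := MonoidHom.ext (ha N)
  rw [L.map_restrict_affineGroup hd, MonoidHom.map_range, hcomp, ← MonoidHom.map_range,
    MonoidHom.range_eq_map (L.affine N),
    Subgroup.relIndex_map_map_of_injective _ _ (L.affine_injective N), Subgroup.relIndex_top_right]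

theorem finiteIndex_range_arborealRep (hd : d ≠ 0)
    (ha : ∀ N σ, (preimageTree f P).restrict N (arborealRep f P σ) = L.affine N (a N σ)) {C : ℕ}
    (hC : ∀ N, (a N).range.index ≤ C) :
    ((arborealRep f P).range.subgroupOf L.affineGroup).FiniteIndex := by
  have : NeZero d := ⟨hd⟩
  have hT := L.parent_surjective hd
  refine finiteIndex_subgroupOf_of_relIndex_map_le (preimageTree f P).restrict
    ((preimageTree f P).antitone_ker_restrict hT) (mem_range_arborealRep hT) C
    (fun N => ?_) fun N => ?_
  · rw [relIndex_map_restrict_range_arborealRep hd ha]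
    exact Subgroup.FiniteIndex.index_ne_zero
  · rw [relIndex_map_restrict_range_arborealRep hd ha]
    exact hC N

variable {Γ₀ : Type*} [LinearOrderedCommGroupWithZero Γ₀] {v : Valuation (AlgebraicClosure K) Γ₀}

theorem exists_labelling_restrict_arborealRep_eq_affine (hf : f.Monic)
    (hc : ∀ i, v (algebraMap K _ (f.coeff i)) ≤ 1) [NeZero f.natDegree] (hvd : v f.natDegree = 1)
    (hv : ∀ (σ : Gal(AlgebraicClosure K/K)) x, v (σ x) = v x) (hP : 1 < v (algebraMap K _ P))
    (hP0 : P ≠ 0) (R : RootTower (AlgebraicClosure K) f.natDegree (algebraMap K _ P)) :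
    ∃ L : (preimageTree f P).ConsistentLabelling f.natDegree, ∀ N σ,
      (preimageTree f P).restrict N (arborealRep f P σ) =
        L.affine N (R.galoisAffine hP0 N σ) := by
  obtain ⟨L, hL⟩ := exists_consistentLabelling_sameLeadingTerm hf hc hvd hP R
  exact ⟨L, fun N σ => L.eq_affine_of_forall fun k =>
    restrict_arborealRep_label hv hL (R.apply_point hP0 σ N k)⟩

end ArborealImage

theorem theorem1_general (K : Type*) [NormedField K] [IsUltrametricDist K] [ProperSpace K]
    (f : Polynomial K) (hmonic : f.Monic) (hgood : HasGoodReduction f)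
    (hdeg : ‖(f.natDegree : K)‖ = 1) (P : K) (hP : P ∉ filledJulia f) :
    ∃ G : Subgroup (preimageTree f P).Aut,
      (preimageTree f P).IsKummerSubgroup f.natDegree G ∧
      (arborealRep f P).range ≤ G ∧
      ((arborealRep f P).range.subgroupOf G).FiniteIndex := by
  have hP1 : 1 < ‖P‖ := lt_of_not_ge fun h => hP (mem_filledJulia_of_norm_le_one hgood h)
  let : NontriviallyNormedField K := { ‹NormedField K› with non_trivial := ⟨P, hP1⟩ }
  have := (isDiscreteValuationRing_and_finite_residueField (K := K)).2
  obtain ⟨v, hvK, hvσ⟩ := exists_galois_invariant_valuation (K := K)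
  have hvd : v f.natDegree = 1 := by
    rw [← map_natCast (algebraMap K _), hvK]
    exact NNReal.eq hdeg
  have hd := ne_zero_of_map_natCast_eq_one hvd
  have : NeZero f.natDegree := ⟨hd⟩
  have hP0 : P ≠ 0 := norm_pos_iff.1 (zero_lt_one.trans hP1)
  obtain ⟨R⟩ := RootTower.nonempty (v.ne_zero_iff.1 (hvd.trans_ne one_ne_zero)) (algebraMap K _ P)
  obtain ⟨m, hm, hdvd⟩ := exists_dvd_mul_of_pow_eq_pow_of_one_lt_norm hP1
  obtain ⟨C, hC⟩ := R.exists_index_range_galoisAffine_le hP0 Finite.one_lt_card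
    (fun N => exists_galois_apply_eq_pow_card_residueField
      (by rw [Nat.cast_pow, norm_pow, hdeg, one_pow]) (R.isPrimitiveRoot N)) hm hdvd
  obtain ⟨L, hL⟩ := exists_labelling_restrict_arborealRep_eq_affine hmonic
    (fun i => (hvK _).trans_le (hgood i)) hvd hvσ ((hvK P).symm ▸ hP1) hP0 R
  exact ⟨L.affineGroup, L.isKummerSubgroup_affineGroup hd, range_arborealRep_le_affineGroup hL,
    finiteIndex_range_arborealRep hd hL hC⟩

theorem theorem1 (p : ℕ) [Fact p.Prime] (K : Type*) [NormedField K] [NormedAlgebra ℚ_[p] K]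
    [FiniteDimensional ℚ_[p] K] (f : Polynomial K) (hmonic : f.Monic)
    (hgood : HasGoodReduction f) (hdeg : ¬ p ∣ f.natDegree) (P : K) (hP : P ∉ filledJulia f) :
    ∃ G : Subgroup (preimageTree f P).Aut,
      (preimageTree f P).IsKummerSubgroup f.natDegree G ∧
      (arborealRep f P).range ≤ G ∧
      ((arborealRep f P).range.subgroupOf G).FiniteIndex := by
  have : IsUltrametricDist K := .of_normedAlgebra ℚ_[p]
  have : ProperSpace K := FiniteDimensional.proper ℚ_[p] K
  refine theorem1_general K f hmonic hgood ?_ P hP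
  rwa [← map_natCast (algebraMap ℚ_[p] K), norm_algebraMap', Padic.norm_natCast_eq_one_iff,
    Nat.Prime.coprime_iff_not_dvd Fact.out]
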